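/- Let $L$ be a frame, with pseudocomplement $x\mapsto x^*$. Let $\mathcal{R}L$ be the commutative ring of continuous real-valued functions on $L$, that is, of frame homomorphisms from the frame of open sets of $\mathbb{R}$ to $L$, where for $\diamond\in\{+,\cdot\}$ one puts $(\alpha\diamond\beta)(W)=\bigvee\{\alpha(U)\wedge\beta(V) : x\diamond y\in W \text{ for all } x\in U,\ y\in V\}$, and where, for $r\in\mathbb{R}$, the constant $\mathbf{r}$ sends $U$ to $1$ if $r\in U$ and to $0$ otherwise. Put $\operatorname{coz}\alpha=\alpha(-\infty,0)\vee\alpha(0,\infty)$, $R_\alpha=\{r\in\mathbb{R} : \operatorname{coz}(\alpha-\mathbf{r})\neq 1\}$ and $\mathcal{R}_cL=\{\alpha\in\mathcal{R}L : R_\alpha \text{ is countable}\}$. Let $BL$ be the lattice of complemented elements of $L$, let $\beta_0L$ be the frame of ideals of $BL$, and for $b\in L$ let $r_0(b)=\{x\in BL : x\le b\}\in\beta_0L$. For $a\in BL$ let $e_a\in\mathcal{R}L$ be the function with $e_a(U)=\bigvee(\{a^* : 0\in U\}\cup\{a : 1\in U\})$. For $I\in\beta_0L$ put $$\mathbf{O}_c^I=\{\alpha\in\mathcal{R}_cL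 : I\vee r_0((\operatorname{coz}\alpha)^*)=1_{\beta_0L}\}.$$ An ideal of $\mathcal{R}_cL$ means a subset $J\subseteq\mathcal{R}_cL$ that contains $0$, contains $\alpha+\beta$ whenever $\alpha,\beta\in J$ and $\alpha+\beta\in\mathcal{R}_cL$, and contains $\rho\alpha$ whenever $\rho\in\mathcal{R}_cL$, $\alpha\in J$ and $\rho\alpha\in\mathcal{R}_cL$. (If $\mathcal{R}_cL$ is a subring of $\mathcal{R}L$, this is the usual notion; for some frames $\mathcal{R}_cL$ is not closed under addition.) Theorem. Let $L$ be any frame and let $I\in\beta_0L$. Then every $e_a$ with $a\in I$ is idempotent, and $\mathbf{O}_c^I$ is the ideal of $\mathcal{R}_cL$ generated by the set $\{e_a : a\in I\}$, that is, the smallest ideal of $\mathcal{R}_cL$ that contains this set. In particular, if $\mathcal{R}_cL$ is a subring of $\mathcal{R}L$, then $\mathbf{O}_c^I$ is the ideal generated by $\{e_a : a\in I\}$ in the ring $\mathcal{R}_cL$. Moreover, for every $\alpha\in\mathbf{O}_c^I$ there are $a\in I$ and $\beta\in\mathcal{R}_cL$ with $\alpha=\beta e_a$. -/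

import Mathlib

open TopologicalSpace

namespace PointfreeReal

section Pairing

variable {X Y Z L : Type*} [TopologicalSpace X] [TopologicalSpace Y] [TopologicalSpace Z]
  [Order.Frame L]

/-- The value at `W` of the pairing of two frame homomorphisms `α : 𝒪X → L` and `β : 𝒪Y → L`:
the join of all `α U ⊓ β V` with `U × V ⊆ W`. -/
def pairFun (α : FrameHom (Opens X) L) (β : FrameHom (Opens Y) L) (W : Opens (X × Y)) : L :=
  ⨆ (U : Opens X) (V : Opens Y) (_ : ∀ x ∈ U, ∀ y ∈ V, (x, y) ∈ W), α U ⊓ β V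

theorem le_pairFun (α : FrameHom (Opens X) L) (β : FrameHom (Opens Y) L) {W : Opens (X × Y)}
    {U : Opens X} {V : Opens Y} (h : ∀ x ∈ U, ∀ y ∈ V, (x, y) ∈ W) :
    α U ⊓ β V ≤ pairFun α β W :=
  le_iSup_of_le U (le_iSup_of_le V (le_iSup_of_le h le_rfl))

theorem pairFun_le (α : FrameHom (Opens X) L) (β : FrameHom (Opens Y) L) {W : Opens (X × Y)}
    {c : L} (h : ∀ (U : Opens X) (V : Opens Y), (∀ x ∈ U, ∀ y ∈ V, (x, y) ∈ W) →
      α U ⊓ β V ≤ c) : pairFun α β W ≤ c :=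
  iSup_le fun U => iSup_le fun V => iSup_le fun hUV => h U V hUV

theorem pairFun_mono (α : FrameHom (Opens X) L) (β : FrameHom (Opens Y) L)
    {W W' : Opens (X × Y)} (h : W ≤ W') : pairFun α β W ≤ pairFun α β W' :=
  pairFun_le α β fun _ _ hUV => le_pairFun α β fun x hx y hy => h (hUV x hx y hy)

/-- On a locally compact space an open set is the join of the open sets that are contained in
a compact subset of it. -/
theorem map_le_of_compact [LocallyCompactSpace X] (α : FrameHom (Opens X) L) (U : Opens X) {c : L}
    (h : ∀ U' : Opens X, ∀ K : Set X, IsCompact K → (U' : Set X) ⊆ K → K ⊆ U → α U' ≤ c) :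
    α U ≤ c := by
  have hU : U ≤ sSup {U' : Opens X | ∃ K : Set X, IsCompact K ∧ (U' : Set X) ⊆ K ∧ K ⊆ U} := by
    intro x hx
    obtain ⟨K, hK, hxK, hKU⟩ := exists_compact_subset U.isOpen hx
    exact Opens.mem_sSup.2 ⟨⟨interior K, isOpen_interior⟩, ⟨K, hK, interior_subset, hKU⟩, hxK⟩
  refine (OrderHomClass.mono α hU).trans ?_
  rw [map_sSup]
  refine sSup_le ?_
  rintro _ ⟨U', ⟨K, hK, h1, h2⟩, rfl⟩
  exact h U' K hK h1 h2

theorem pairFun_compact (α : FrameHom (Opens X) L) (β : FrameHom (Opens Y) L) (c : L)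
    {K : Set X} {K' : Set Y} (hK : IsCompact K) (hK' : IsCompact K')
    (h : ∀ x ∈ K, ∀ y ∈ K', ∃ (U : Opens X) (V : Opens Y), x ∈ U ∧ y ∈ V ∧ α U ⊓ β V ≤ c) :
    ∃ (U : Opens X) (V : Opens Y), K ⊆ U ∧ K' ⊆ V ∧ α U ⊓ β V ≤ c := by
  refine hK.induction_on
    (p := fun s => ∃ (U : Opens X) (V : Opens Y), s ⊆ U ∧ K' ⊆ V ∧ α U ⊓ β V ≤ c)
    ⟨⊥, ⊤, by simp, by simp, by simp⟩ ?_ ?_ ?_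
  · rintro s t hst ⟨U, V, hU, hV, hc⟩
    exact ⟨U, V, hst.trans hU, hV, hc⟩
  · rintro s t ⟨U, V, hU, hV, hc⟩ ⟨U', V', hU', hV', hc'⟩
    refine ⟨U ⊔ U', V ⊓ V', ?_, ?_, ?_⟩
    · rw [Opens.coe_sup]
      exact Set.union_subset_union hU hU'
    · rw [Opens.coe_inf]
      exact Set.subset_inter hV hV'
    · rw [map_sup, map_inf, inf_sup_right]
      exact sup_le ((inf_le_inf_left _ inf_le_left).trans hc)
        ((inf_le_inf_left _ inf_le_right).trans hc')
  · intro x hx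
    have key : ∃ (U : Opens X) (V : Opens Y), x ∈ U ∧ K' ⊆ V ∧ α U ⊓ β V ≤ c := by
      refine hK'.induction_on
        (p := fun t => ∃ (U : Opens X) (V : Opens Y), x ∈ U ∧ t ⊆ V ∧ α U ⊓ β V ≤ c)
        ⟨⊤, ⊥, by simp, by simp, by simp⟩ ?_ ?_ ?_
      · rintro s t hst ⟨U, V, hU, hV, hc⟩
        exact ⟨U, V, hU, hst.trans hV, hc⟩
      · rintro s t ⟨U, V, hU, hV, hc⟩ ⟨U', V', hU', hV', hc'⟩
        refine ⟨U ⊓ U', V ⊔ V', ⟨hU, hU'⟩, ?_, ?_⟩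
        · rw [Opens.coe_sup]
          exact Set.union_subset_union hV hV'
        · rw [map_sup, map_inf, inf_sup_left]
          exact sup_le ((inf_le_inf_right _ inf_le_left).trans hc)
            ((inf_le_inf_right _ inf_le_right).trans hc')
      · intro y hy
        obtain ⟨U, V, hU, hV, hc⟩ := h x hx y hy
        exact ⟨V, mem_nhdsWithin_of_mem_nhds (V.isOpen.mem_nhds hV), U, V, hU, subset_rfl, hc⟩
    obtain ⟨U, V, hU, hV, hc⟩ := key
    exact ⟨U, mem_nhdsWithin_of_mem_nhds (U.isOpen.mem_nhds hU), U, V, subset_rfl, hV, hc⟩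

/-- The pairing `𝒪(X × Y) → L` of `α : 𝒪X → L` and `β : 𝒪Y → L` for locally compact `X`, `Y`. -/
def pair [LocallyCompactSpace X] [LocallyCompactSpace Y]
    (α : FrameHom (Opens X) L) (β : FrameHom (Opens Y) L) : FrameHom (Opens (X × Y)) L where
  toFun := pairFun α β
  map_inf' W W' := by
    refine le_antisymm (le_inf (pairFun_mono α β inf_le_left) (pairFun_mono α β inf_le_right)) ?_
    simp only [pairFun, iSup_inf_eq, inf_iSup_eq]
    refine iSup_le fun U => iSup_le fun V => iSup_le fun h => iSup_le fun U' => iSup_le fun V' =>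
      iSup_le fun h' => ?_
    refine le_trans (le_of_eq ?_) (le_pairFun α β (U := U ⊓ U') (V := V ⊓ V')
      fun x hx y hy => ⟨h' x hx.2 y hy.2, h x hx.1 y hy.1⟩)
    rw [map_inf, map_inf]
    ac_rfl
  map_top' := by
    refine top_le_iff.1 (le_trans ?_ (le_pairFun α β (U := ⊤) (V := ⊤) fun _ _ _ _ => trivial))
    simp
  map_sSup' S := by
    refine le_antisymm ?_ (sSup_le ?_)
    · refine pairFun_le α β fun U V hUV => ?_
      rw [inf_comm, ← le_himp_iff]
      refine map_le_of_compact β V fun V' K' hK' hV' hKV' => ?_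
      rw [le_himp_iff, inf_comm, ← le_himp_iff]
      refine map_le_of_compact α U fun U' K hK hU' hKU => ?_
      rw [le_himp_iff]
      obtain ⟨A, B, hA, hB, hc⟩ := pairFun_compact α β (sSup (pairFun α β '' S)) hK hK' (by
        intro x hx y hy
        obtain ⟨W, hW, hxy⟩ := Opens.mem_sSup.1 (hUV x (hKU hx) y (hKV' hy))
        obtain ⟨A, B, hA, hB, hxA, hyB, hAB⟩ := isOpen_prod_iff.1 W.isOpen x y hxy
        exact ⟨⟨A, hA⟩, ⟨B, hB⟩, hxA, hyB, (le_pairFun α β (W := W)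
          fun x hx y hy => hAB ⟨hx, hy⟩).trans (le_sSup ⟨W, hW, rfl⟩)⟩)
      exact (inf_le_inf (OrderHomClass.mono α (hU'.trans hA))
        (OrderHomClass.mono β (hV'.trans hB))).trans hc
    · rintro _ ⟨W, hW, rfl⟩
      exact pairFun_mono α β (le_sSup hW)

variable [LocallyCompactSpace X] [LocallyCompactSpace Y]

theorem pair_apply (α : FrameHom (Opens X) L) (β : FrameHom (Opens Y) L) (W : Opens (X × Y)) :
    pair α β W = ⨆ (U : Opens X) (V : Opens Y) (_ : ∀ x ∈ U, ∀ y ∈ V, (x, y) ∈ W), α U ⊓ β V :=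
  rfl

theorem pair_fst (α : FrameHom (Opens X) L) (β : FrameHom (Opens Y) L) :
    (pair α β).comp (Opens.comap ContinuousMap.fst) = α := by
  ext U
  refine le_antisymm (pairFun_le α β fun A B h => ?_) ?_
  · by_cases hB : B = ⊥
    · simp [hB]
    · obtain ⟨y, hy⟩ := Opens.ne_bot_iff_nonempty B |>.1 hB
      exact inf_le_left.trans (OrderHomClass.mono α fun x hx => h x hx y hy)
  · refine le_trans ?_ (le_pairFun α β (U := U) (V := ⊤) fun x hx _ _ => hx)
    simp

theorem pair_snd (α : FrameHom (Opens X) L) (β : FrameHom (Opens Y) L) :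
    (pair α β).comp (Opens.comap ContinuousMap.snd) = β := by
  ext V
  refine le_antisymm (pairFun_le α β fun A B h => ?_) ?_
  · by_cases hA : A = ⊥
    · simp [hA]
    · obtain ⟨x, hx⟩ := Opens.ne_bot_iff_nonempty A |>.1 hA
      exact inf_le_right.trans (OrderHomClass.mono β fun y hy => h x hx y hy)
  · refine le_trans ?_ (le_pairFun α β (U := ⊤) (V := V) fun _ _ y hy => hy)
    simp

theorem pair_comap (T : FrameHom (Opens Z) L) (f : C(Z, X)) (g : C(Z, Y)) :
    pair (T.comp (Opens.comap f)) (T.comp (Opens.comap g)) =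
      T.comp (Opens.comap (f.prodMk g)) := by
  ext W
  refine le_antisymm (pairFun_le _ _ fun U V h => ?_) ?_
  · change T (Opens.comap f U) ⊓ T (Opens.comap g V) ≤ T (Opens.comap (f.prodMk g) W)
    rw [← map_inf]
    exact OrderHomClass.mono T fun z hz => h _ hz.1 _ hz.2
  · have hW : Opens.comap (f.prodMk g) W ≤ sSup {O | ∃ (U : Opens X) (V : Opens Y),
        (∀ x ∈ U, ∀ y ∈ V, (x, y) ∈ W) ∧ O = Opens.comap f U ⊓ Opens.comap g V} := by
      intro z hz
      obtain ⟨A, B, hA, hB, hxA, hyB, hAB⟩ := isOpen_prod_iff.1 W.isOpen (f z) (g z) hz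
      exact Opens.mem_sSup.2 ⟨_, ⟨⟨A, hA⟩, ⟨B, hB⟩, fun x hx y hy => hAB ⟨hx, hy⟩, rfl⟩, hxA, hyB⟩
    refine (OrderHomClass.mono T hW).trans ?_
    rw [map_sSup]
    refine sSup_le ?_
    rintro _ ⟨_, ⟨U, V, h, rfl⟩, rfl⟩
    rw [map_inf]
    exact le_pairFun (T.comp (Opens.comap f)) (T.comp (Opens.comap g)) h

end Pairing

/-- `R L`: the continuous real-valued functions on the frame `L`, that is, the frame
homomorphisms from the frame of open sets of the real line to `L`. -/
abbrev R (L : Type*) [Order.Frame L] : Type _ := FrameHom (Opens ℝ) L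

variable {L : Type*} [Order.Frame L]

/-- The open interval `(-, r)`. -/
def below (r : ℝ) : Opens ℝ := ⟨Set.Iio r, isOpen_Iio⟩

/-- The open interval `(r, -)`. -/
def above (r : ℝ) : Opens ℝ := ⟨Set.Ioi r, isOpen_Ioi⟩

/-- The constant function `r`: an open set is sent to the top if it contains `r`, and to the
bottom otherwise. -/
def const (r : ℝ) : R L where
  toFun U := ⨆ _ : r ∈ U, ⊤
  map_inf' U V := by
    by_cases hU : r ∈ U <;> by_cases hV : r ∈ V <;> simp [Opens.mem_inf, hU, hV]
  map_top' := by simp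
  map_sSup' S := by
    refine le_antisymm (iSup_le fun h => ?_) (sSup_le ?_)
    · obtain ⟨U, hU, hr⟩ := Opens.mem_sSup.1 h
      exact le_sSup_of_le ⟨U, hU, rfl⟩ (le_iSup_of_le hr le_rfl)
    · rintro _ ⟨U, hU, rfl⟩
      exact iSup_le fun hr => le_iSup_of_le (Opens.mem_sSup.2 ⟨U, hU, hr⟩) le_rfl

/-- The result of applying a binary operation `f` on the reals to `α` and `β`: by `op_apply` its
value at `W` is the join of all `α U ⊓ β V` such that `f` maps `U × V` into `W`. -/
def op (f : C(ℝ × ℝ, ℝ)) (α β : R L) : R L := (pair α β).comp (Opens.comap f)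

theorem op_apply (f : C(ℝ × ℝ, ℝ)) (α β : R L) (W : Opens ℝ) :
    op f α β W =
      ⨆ (U : Opens ℝ) (V : Opens ℝ) (_ : ∀ x ∈ U, ∀ y ∈ V, f (x, y) ∈ W), α U ⊓ β V :=
  rfl

instance : Zero (R L) := ⟨const 0⟩
instance : One (R L) := ⟨const 1⟩
instance : Add (R L) := ⟨op ⟨fun p => p.1 + p.2, by fun_prop⟩⟩
instance : Mul (R L) := ⟨op ⟨fun p => p.1 * p.2, by fun_prop⟩⟩

/-- The negative of `α` sends `W` to `α {x | -x ∈ W}`. -/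
instance : Neg (R L) := ⟨fun α => α.comp (Opens.comap ⟨fun x => -x, by fun_prop⟩)⟩

section Transfer

variable {X : Type*} [TopologicalSpace X]

/-- A frame homomorphism `T : 𝒪X → L` sends continuous functions on `X` to elements of `R L`. -/
def pull (T : FrameHom (Opens X) L) (f : C(X, ℝ)) : R L := T.comp (Opens.comap f)

theorem pull_add (T : FrameHom (Opens X) L) (f g : C(X, ℝ)) :
    pull T f + pull T g = pull T (f + g) := by
  change (pair _ _).comp _ = _
  rw [pull, pull, pair_comap]
  rfl

theorem pull_mul (T : FrameHom (Opens X) L) (f g : C(X, ℝ)) :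
    pull T f * pull T g = pull T (f * g) := by
  change (pair _ _).comp _ = _
  rw [pull, pull, pair_comap]
  rfl

theorem pull_neg (T : FrameHom (Opens X) L) (f : C(X, ℝ)) : -pull T f = pull T (-f) := rfl

theorem pull_const (T : FrameHom (Opens X) L) (r : ℝ) :
    (const r : R L) = pull T (ContinuousMap.const X r) := by
  ext U
  change (⨆ _ : r ∈ U, ⊤) = T (Opens.comap (ContinuousMap.const X r) U)
  by_cases h : r ∈ U
  · have : Opens.comap (ContinuousMap.const X r) U = ⊤ := by ext; simp [h]
    simp [this, h]
  · have : Opens.comap (ContinuousMap.const X r) U = ⊥ := by ext; simp [h]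
    simp [this, h]

theorem pull_zero (T : FrameHom (Opens X) L) : (0 : R L) = pull T 0 := pull_const T 0

theorem pull_one (T : FrameHom (Opens X) L) : (1 : R L) = pull T 1 := pull_const T 1

theorem exists_pull (α β γ : R L) : ∃ (T : FrameHom (Opens ((ℝ × ℝ) × ℝ)) L)
    (f g h : C((ℝ × ℝ) × ℝ, ℝ)), α = pull T f ∧ β = pull T g ∧ γ = pull T h := by
  refine ⟨pair (pair α β) γ, ContinuousMap.fst.comp ContinuousMap.fst,
    ContinuousMap.snd.comp ContinuousMap.fst, ContinuousMap.snd, ?_, ?_, ?_⟩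
  · rw [pull, Opens.comap_comp, ← FrameHom.comp_assoc, pair_fst, pair_fst]
  · rw [pull, Opens.comap_comp, ← FrameHom.comp_assoc, pair_fst, pair_snd]
  · rw [pull, pair_snd]

end Transfer

/-- `R L` is a commutative ring. -/
instance : CommRing (R L) where
  add_assoc α β γ := by
    obtain ⟨T, f, g, h, rfl, rfl, rfl⟩ := exists_pull α β γ
    simp only [pull_add, add_assoc]
  zero_add α := by
    obtain ⟨T, f, g, h, rfl, -, -⟩ := exists_pull α α α
    rw [pull_zero T, pull_add, zero_add]
  add_zero α := by
    obtain ⟨T, f, g, h, rfl, -, -⟩ := exists_pull α α α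
    rw [pull_zero T, pull_add, add_zero]
  add_comm α β := by
    obtain ⟨T, f, g, h, rfl, rfl, -⟩ := exists_pull α β α
    rw [pull_add, pull_add, add_comm]
  neg_add_cancel α := by
    obtain ⟨T, f, g, h, rfl, -, -⟩ := exists_pull α α α
    rw [pull_neg, pull_add, pull_zero T, neg_add_cancel]
  mul_assoc α β γ := by
    obtain ⟨T, f, g, h, rfl, rfl, rfl⟩ := exists_pull α β γ
    simp only [pull_mul, mul_assoc]
  one_mul α := by
    obtain ⟨T, f, g, h, rfl, -, -⟩ := exists_pull α α α
    rw [pull_one T, pull_mul, one_mul]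
  mul_one α := by
    obtain ⟨T, f, g, h, rfl, -, -⟩ := exists_pull α α α
    rw [pull_one T, pull_mul, mul_one]
  mul_comm α β := by
    obtain ⟨T, f, g, h, rfl, rfl, -⟩ := exists_pull α β α
    rw [pull_mul, pull_mul, mul_comm]
  zero_mul α := by
    obtain ⟨T, f, g, h, rfl, -, -⟩ := exists_pull α α α
    rw [pull_zero T, pull_mul, zero_mul]
  mul_zero α := by
    obtain ⟨T, f, g, h, rfl, -, -⟩ := exists_pull α α α
    rw [pull_zero T, pull_mul, mul_zero]
  left_distrib α β γ := by
    obtain ⟨T, f, g, h, rfl, rfl, rfl⟩ := exists_pull α β γ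
    simp only [pull_mul, pull_add, mul_add]
  right_distrib α β γ := by
    obtain ⟨T, f, g, h, rfl, rfl, rfl⟩ := exists_pull α β γ
    simp only [pull_mul, pull_add, add_mul]
  nsmul := nsmulRec
  zsmul := zsmulRec

/-- The cozero element `α(-, 0) ⊔ α(0, -)` of `α`. -/
def coz (α : R L) : L := α (below 0) ⊔ α (above 0)

/-- The pointfree image of `α`: the set of all reals `r` with `coz (α - r) ≠ 1`. -/
def image (α : R L) : Set ℝ := {r | coz (α - const r) ≠ ⊤}

variable (L) in
/-- `R_c L`: the elements of `R L` that have a countable pointfree image. -/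
def Rc : Set (R L) := {α | (image α).Countable}

variable (L) in
/-- `β₀ L`: the frame of all ideals of the lattice `B L` of complemented elements of `L`. -/
abbrev BetaZero : Type _ := Order.Ideal (Complementeds L)

/-- The ideal `r₀(b) = {x ∈ B L | x ≤ b}` of `B L`. -/
def rZero (b : L) : BetaZero L where
  carrier := {x | (x : L) ≤ b}
  lower' _ _ hyx hx := le_trans hyx hx
  nonempty' := ⟨⊥, bot_le⟩
  directed' x hx y hy := ⟨x ⊔ y, sup_le hx hy, le_sup_left, le_sup_right⟩

/-- The join map `j₀ : β₀ L → L`. -/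
def jZero (I : BetaZero L) : L := ⨆ x ∈ I, (x : L)

theorem gc_jZero_rZero : GaloisConnection (jZero (L := L)) rZero := by
  intro I b
  simp only [jZero, iSup_le_iff]
  rfl

/-- The set `O_c^I` of all `α` in `R_c L` with `I ∨ r₀((coz α)*) = 1` in `β₀ L`. -/
def Oc (I : BetaZero L) : Set (R L) := {α | α ∈ Rc L ∧ I ⊔ rZero ((coz α)ᶜ) = ⊤}

/-- The element `e_a` of `R L` for a complemented element `a` of `L`: an open set `U` is sent to
the join of `a*` (if `0 ∈ U`) and `a` (if `1 ∈ U`); `e_Ioo` lists the values on intervals. -/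
def e (a : Complementeds L) : R L where
  toFun U := (⨆ _ : (0 : ℝ) ∈ U, (a : L)ᶜ) ⊔ ⨆ _ : (1 : ℝ) ∈ U, (a : L)
  map_inf' U V := by
    have h : (a : L)ᶜ ⊓ a = ⊥ := compl_inf_self _
    have h' : (a : L) ⊓ (a : L)ᶜ = ⊥ := inf_compl_self _
    by_cases h0U : (0 : ℝ) ∈ U <;> by_cases h0V : (0 : ℝ) ∈ V <;>
    by_cases h1U : (1 : ℝ) ∈ U <;> by_cases h1V : (1 : ℝ) ∈ V <;>
    simp [Opens.mem_inf, h0U, h0V, h1U, h1V, h, h']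
  map_top' := by
    have h : (a : L)ᶜ ⊔ a = ⊤ := by
      obtain ⟨b, hb⟩ := a.2
      rw [hb.compl_eq]
      exact hb.symm.sup_eq_top
    simpa using h
  map_sSup' S := by
    refine le_antisymm (sup_le (iSup_le fun h => ?_) (iSup_le fun h => ?_)) (sSup_le ?_)
    · obtain ⟨U, hU, hr⟩ := Opens.mem_sSup.1 h
      exact le_sSup_of_le ⟨U, hU, rfl⟩ (le_sup_of_le_left (le_iSup_of_le hr le_rfl))
    · obtain ⟨U, hU, hr⟩ := Opens.mem_sSup.1 h
      exact le_sSup_of_le ⟨U, hU, rfl⟩ (le_sup_of_le_right (le_iSup_of_le hr le_rfl))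
    · rintro _ ⟨U, hU, rfl⟩
      exact sup_le_sup
        (iSup_le fun hr => le_iSup_of_le (Opens.mem_sSup.2 ⟨U, hU, hr⟩) le_rfl)
        (iSup_le fun hr => le_iSup_of_le (Opens.mem_sSup.2 ⟨U, hU, hr⟩) le_rfl)

theorem e_Ioo (a : Complementeds L) (p q : ℝ) :
    ((p < q ∧ q ≤ 0) ∨ (1 ≤ p ∧ p < q) → e a ⟨Set.Ioo p q, isOpen_Ioo⟩ = ⊥) ∧
    (p < 0 ∧ 0 < q ∧ q ≤ 1 → e a ⟨Set.Ioo p q, isOpen_Ioo⟩ = (a : L)ᶜ) ∧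
    (0 ≤ p ∧ p < 1 ∧ 1 < q → e a ⟨Set.Ioo p q, isOpen_Ioo⟩ = (a : L)) ∧
    (p < 0 ∧ 1 < q → e a ⟨Set.Ioo p q, isOpen_Ioo⟩ = ⊤) := by
  have hv : e a ⟨Set.Ioo p q, isOpen_Ioo⟩ =
      (⨆ _ : p < 0 ∧ 0 < q, (a : L)ᶜ) ⊔ ⨆ _ : p < 1 ∧ 1 < q, (a : L) := rfl
  refine ⟨fun h => ?_, fun h => ?_, fun h => ?_, fun h => ?_⟩
  · have h0 : ¬ (p < 0 ∧ 0 < q) := by rintro ⟨h1, h2⟩; rcases h with h | h <;> linarith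
    have h1 : ¬ (p < 1 ∧ 1 < q) := by rintro ⟨h1, h2⟩; rcases h with h | h <;> linarith
    rw [hv, iSup_neg h0, iSup_neg h1, bot_sup_eq]
  · rw [hv, iSup_pos ⟨h.1, h.2.1⟩, iSup_neg (fun h' => absurd h'.2 (not_lt.2 h.2.2)), sup_bot_eq]
  · rw [hv, iSup_neg (fun h' => absurd h'.1 (not_lt.2 h.1)), iSup_pos h.2, bot_sup_eq]
  · rw [hv, iSup_pos ⟨h.1, by linarith⟩, iSup_pos ⟨by linarith, h.2⟩]
    obtain ⟨b, hb⟩ := a.2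
    rw [hb.compl_eq]
    exact hb.symm.sup_eq_top

end PointfreeReal

/-- `J` is an ideal of the subset `A` of the commutative ring `S`: it is a subset of `A` that
contains `0`, every sum of two of its elements that lies in `A`, and every product of an element
of `A` and an element of `J` that lies in `A`. If `A` is a subring, these are the ideals of `A` in
the usual sense; the set `A` need not be closed under addition or multiplication. -/
structure IsIdealOfSet {S : Type*} [CommRing S] (A J : Set S) : Prop where
  subset : J ⊆ A
  zero_mem : 0 ∈ J
  add_mem : ∀ x ∈ J, ∀ y ∈ J, x + y ∈ A → x + y ∈ J
  mul_mem : ∀ r ∈ A, ∀ x ∈ J, r * x ∈ A → r * x ∈ J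

namespace PointfreeReal

/-! ### Cozero elements, computed on spaces of points. -/

section Cozero

variable {X : Type*} [TopologicalSpace X] {L : Type*} [Order.Frame L]

/-! Membership of `α` in `Oc I` amounts to `coz α ≤ a` for some `a ∈ I` (`mem_Oc_iff`). For such an
`a`, `coz (e a - 1)` is the complement of `a`, so `α * (e a - 1)` has cozero element `⊥` and
vanishes: `α = α * e a` (`mul_e_eq_self`). Hence every ideal containing the `e a` contains `Oc I`,
and `β = α` serves in the last claim. Conversely `coz (e a) = a` puts `e a` in `Oc I`, and the rules
for `coz` of sums and products make `Oc I` an ideal. No sums of multiples of the generators are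
needed, and the only product formed is `α` itself, so it does not matter whether `Rc L` is closed
under the operations. -/

theorem pull_sub (T : FrameHom (Opens X) L) (f g : C(X, ℝ)) :
    pull T f - pull T g = pull T (f - g) := by
  rw [sub_eq_add_neg, pull_neg, pull_add, sub_eq_add_neg]

theorem pull_id (α : R L) : pull α (ContinuousMap.id ℝ) = α := rfl

/-- The open set of nonzero real numbers. -/
def nonzero : Opens ℝ := below 0 ⊔ above 0

theorem mem_nonzero {x : ℝ} : x ∈ nonzero ↔ x ≠ 0 :=
  (lt_or_lt_iff_ne : x < 0 ∨ 0 < x ↔ x ≠ 0)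

theorem coz_eq (α : R L) : coz α = α nonzero := (map_sup α _ _).symm

theorem coz_pull (T : FrameHom (Opens X) L) (f : C(X, ℝ)) :
    coz (pull T f) = T (Opens.comap f nonzero) := coz_eq _

theorem mem_comap_nonzero {f : C(X, ℝ)} {x : X} : x ∈ Opens.comap f nonzero ↔ f x ≠ 0 :=
  mem_nonzero

/-- By `exists_pull` both elements come from real functions on one space, where the claim is
pointwise: a product of reals is nonzero exactly when both factors are. -/
theorem coz_mul (α β : R L) : coz (α * β) = coz α ⊓ coz β := by
  obtain ⟨T, f, g, -, rfl, rfl, -⟩ := exists_pull α β 0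
  rw [pull_mul, coz_pull, coz_pull, coz_pull, ← map_inf]
  congr 1
  ext x
  exact mem_comap_nonzero.trans
    (mul_ne_zero_iff.trans (and_congr mem_comap_nonzero mem_comap_nonzero).symm)

theorem coz_add_le (α β : R L) : coz (α + β) ≤ coz α ⊔ coz β := by
  obtain ⟨T, f, g, -, rfl, rfl, -⟩ := exists_pull α β 0
  rw [pull_add, coz_pull, coz_pull, coz_pull, ← map_sup]
  refine OrderHomClass.mono T fun x hx => ?_
  by_cases hf : f x = 0
  · refine Or.inr (mem_comap_nonzero.2 fun hg => mem_comap_nonzero.1 hx ?_)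
    rw [ContinuousMap.add_apply, hf, hg, add_zero]
  · exact Or.inl (mem_comap_nonzero.2 hf)

theorem coz_zero : coz (0 : R L) = ⊥ := by
  rw [coz_eq]
  exact iSup_neg fun h => mem_nonzero.1 h rfl

/-- An open set containing 0 covers the line together with `nonzero`; one missing 0 lies inside
`nonzero`. So `α` takes the values of `const 0`. -/
theorem eq_zero_of_coz_eq_bot {α : R L} (h : coz α = ⊥) : α = 0 := by
  rw [coz_eq] at h
  ext U
  change α U = ⨆ _ : (0 : ℝ) ∈ U, ⊤
  by_cases h0 : (0 : ℝ) ∈ U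
  · have hU : U ⊔ nonzero = ⊤ := top_le_iff.1 fun x _ => by
      by_cases hx : x = 0
      · exact Or.inl (hx ▸ h0)
      · exact Or.inr (mem_nonzero.2 hx)
    rw [iSup_pos h0, ← map_top α, ← hU, map_sup, h, sup_bot_eq]
  · rw [iSup_neg h0, ← le_bot_iff, ← h]
    exact OrderHomClass.mono α fun x hx => mem_nonzero.2 fun hx0 => h0 (hx0 ▸ hx)

/-- Since `α` is the pull of the identity along itself, `α - const r` is the pull of `x ↦ x - r`,
and its cozero element is `α` of the line without `r`. -/
theorem coz_sub_const (α : R L) (r : ℝ) :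
    coz (α - const r) =
      α (Opens.comap (ContinuousMap.id ℝ - ContinuousMap.const ℝ r) nonzero) := by
  rw [pull_const α r, ← coz_pull, ← pull_sub, pull_id]

theorem mem_comap_sub_const {r x : ℝ} :
    x ∈ Opens.comap (ContinuousMap.id ℝ - ContinuousMap.const ℝ r) nonzero ↔ x ≠ r :=
  mem_comap_nonzero.trans sub_ne_zero

theorem zero_mem_Rc : (0 : R L) ∈ Rc L := by
  refine (Set.countable_singleton (0 : ℝ)).mono fun r hr => ?_
  by_contra h
  refine hr ?_
  rw [coz_sub_const]
  exact iSup_pos (mem_comap_sub_const.2 (Ne.symm h))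

end Cozero

/-! ### The idempotents `e a` and the ideal `Oc I`. -/

section ComplementedElement

variable {L : Type*} [Order.Frame L]

theorem compl_sup_coe (a : Complementeds L) : (a : L)ᶜ ⊔ a = ⊤ := by
  obtain ⟨b, hb⟩ := a.2
  rw [hb.compl_eq]
  exact hb.symm.sup_eq_top

theorem e_apply (a : Complementeds L) (U : Opens ℝ) :
    e a U = (⨆ _ : (0 : ℝ) ∈ U, (a : L)ᶜ) ⊔ ⨆ _ : (1 : ℝ) ∈ U, (a : L) := rfl

theorem isIdempotentElem_e (a : Complementeds L) : IsIdempotentElem (e a) := by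
  have h : e a * e a = pull (e a) (ContinuousMap.id ℝ * ContinuousMap.id ℝ) :=
    pull_mul (e a) (ContinuousMap.id ℝ) (ContinuousMap.id ℝ)
  refine h.trans ?_
  ext U
  change e a (Opens.comap (ContinuousMap.id ℝ * ContinuousMap.id ℝ) U) = _
  -- The value of `e a` at an open set depends only on whether 0 and 1 belong to it, and squaring
  -- fixes both points.
  rw [e_apply, e_apply]
  simp [Opens.mem_comap]

theorem coz_e (a : Complementeds L) : coz (e a) = a := by
  rw [coz_eq, e_apply, iSup_neg (fun h => mem_nonzero.1 h rfl),
    iSup_pos (mem_nonzero.2 one_ne_zero), bot_sup_eq]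

theorem coz_e_sub_one (a : Complementeds L) : coz (e a - 1) = (a : L)ᶜ := by
  change coz (e a - const 1) = _
  rw [coz_sub_const, e_apply, iSup_pos (mem_comap_sub_const.2 zero_ne_one),
    iSup_neg (fun h => mem_comap_sub_const.1 h rfl), sup_bot_eq]

/-- The image lies in `{0, 1}`: for any other `r` the line without `r` contains 0 and 1, so `e a`
sends it to the join of `a` and its complement. -/
theorem e_mem_Rc (a : Complementeds L) : e a ∈ Rc L := by
  refine (Set.toFinite ({0, 1} : Set ℝ)).countable.mono fun r hr => ?_
  by_contra h
  rw [Set.mem_insert_iff, Set.mem_singleton_iff, not_or] at h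
  refine hr ?_
  rw [coz_sub_const, e_apply, iSup_pos (mem_comap_sub_const.2 (Ne.symm h.1)),
    iSup_pos (mem_comap_sub_const.2 (Ne.symm h.2)), compl_sup_coe]

theorem mul_e_eq_self {α : R L} {a : Complementeds L} (h : coz α ≤ a) : α * e a = α := by
  have h0 : α * (e a - 1) = 0 := eq_zero_of_coz_eq_bot <| by
    rw [coz_mul, coz_e_sub_one, ← le_bot_iff, ← inf_compl_self (a : L)]
    exact inf_le_inf_right _ h
  rwa [mul_sub, mul_one, sub_eq_zero] at h0

theorem mem_Oc_iff {I : BetaZero L} {α : R L} :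
    α ∈ Oc I ↔ α ∈ Rc L ∧ ∃ a ∈ I, coz α ≤ (a : L) := by
  refine and_congr_right fun _ => ⟨fun h => ?_, ?_⟩
  · have ht : (⊤ : Complementeds L) ∈ I ⊔ rZero ((coz α)ᶜ) := h ▸ trivial
    obtain ⟨a, ha, b, hb, hab⟩ := Order.Ideal.mem_sup.1 ht
    refine ⟨a, ha, ?_⟩
    have hab' : (⊤ : L) ≤ (a : L) ⊔ b := hab
    -- `a` and `b` cover the top and `coz α` misses `b`, so `coz α` lies below `a`.
    have hd : Disjoint (coz α) (b : L) := le_compl_iff_disjoint_left.1 hb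
    exact hd.left_le_of_le_sup_right (le_top.trans hab')
  · rintro ⟨a, ha, hle⟩
    refine top_le_iff.1 fun x _ => Order.Ideal.mem_sup.2 ?_
    obtain ⟨b, hb⟩ := a.2
    -- The complement `b` of `a` is itself complemented, and lies below the pseudocomplement of `coz
    -- α` because `coz α ≤ a`.
    refine ⟨a, ha, ⟨b, a, hb.symm⟩, ?_, ?_⟩
    · change b ≤ (coz α)ᶜ
      rw [← hb.compl_eq]
      exact compl_le_compl hle
    · change (x : L) ≤ (a : L) ⊔ b
      exact le_top.trans hb.sup_eq_top.ge

theorem e_mem_Oc {I : BetaZero L} {a : Complementeds L} (ha : a ∈ I) : e a ∈ Oc I :=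
  mem_Oc_iff.2 ⟨e_mem_Rc a, a, ha, (coz_e a).le⟩

theorem isIdealOfSet_Oc (I : BetaZero L) : IsIdealOfSet (Rc L) (Oc I) where
  subset _ h := h.1
  zero_mem := by
    obtain ⟨a, ha⟩ := I.nonempty
    exact mem_Oc_iff.2 ⟨zero_mem_Rc, a, ha, coz_zero.le.trans bot_le⟩
  add_mem α hα β hβ h := by
    obtain ⟨-, a, ha, hαa⟩ := mem_Oc_iff.1 hα
    obtain ⟨-, b, hb, hβb⟩ := mem_Oc_iff.1 hβ
    exact mem_Oc_iff.2 ⟨h, a ⊔ b, Order.Ideal.sup_mem ha hb,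
      (coz_add_le α β).trans (sup_le_sup hαa hβb)⟩
  mul_mem ρ _ α hα h := by
    obtain ⟨-, a, ha, hαa⟩ := mem_Oc_iff.1 hα
    exact mem_Oc_iff.2 ⟨h, a, ha, (coz_mul ρ α).le.trans (inf_le_right.trans hαa)⟩

end ComplementedElement

end PointfreeReal

/-! ### Ideals of a subring, and the theorem. -/

/-- The ideals of a subring, as ideals of its underlying set. -/
def IsIdealOfSet.toIdeal {S : Type*} [CommRing S] {A : Subring S} {J : Set S}
    (h : IsIdealOfSet (A : Set S) J) : Ideal A where
  carrier := {x | (x : S) ∈ J}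
  zero_mem' := h.zero_mem
  add_mem' {x y} hx hy := h.add_mem x hx y hy (x + y).2
  smul_mem' r x hx := h.mul_mem r r.2 x hx (r * x).2

theorem theorem4p4 {L : Type*} [Order.Frame L] (I : PointfreeReal.BetaZero L) :
    (∀ a ∈ I, IsIdempotentElem (PointfreeReal.e a)) ∧
    IsLeast {J : Set (PointfreeReal.R L) |
      IsIdealOfSet (PointfreeReal.Rc L) J ∧ ∀ a ∈ I, PointfreeReal.e a ∈ J}
      (PointfreeReal.Oc I) ∧
    (∀ A : Subring (PointfreeReal.R L), (A : Set (PointfreeReal.R L)) = PointfreeReal.Rc L →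
      ((Ideal.span {x : A | ∃ a ∈ I, (x : PointfreeReal.R L) = PointfreeReal.e a} : Ideal A) :
        Set A) = {x : A | (x : PointfreeReal.R L) ∈ PointfreeReal.Oc I}) ∧
    (∀ α ∈ PointfreeReal.Oc I, ∃ a ∈ I, ∃ β ∈ PointfreeReal.Rc L,
      α = β * PointfreeReal.e a) := by
  open PointfreeReal in
  refine ⟨fun a _ => isIdempotentElem_e a,
    ⟨⟨isIdealOfSet_Oc I, fun a => e_mem_Oc⟩, ?_⟩, ?_, ?_⟩
  · rintro J ⟨hJ, he⟩ α hα
    obtain ⟨hc, a, ha, hle⟩ := mem_Oc_iff.1 hα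
    have h := mul_e_eq_self hle
    -- The product `α * e a` is admissible because it equals `α`, which is in `Rc L`.
    exact h ▸ hJ.mul_mem α hc (e a) (he a ha) (h.symm ▸ hc)
  · intro A hA
    refine Set.Subset.antisymm ?_ ?_
    · have hI : IsIdealOfSet (A : Set (R L)) (Oc I) := hA ▸ isIdealOfSet_Oc I
      -- As `A` is a subring, `Oc I` gives a genuine ideal of `A`, so it suffices that it contains
      -- the generators.
      refine (Ideal.span_le (I := hI.toIdeal)).2 ?_
      rintro x ⟨a, ha, hx⟩
      change (x : R L) ∈ Oc I
      exact hx ▸ e_mem_Oc ha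
    · intro x hx
      obtain ⟨-, a, ha, hle⟩ := mem_Oc_iff.1 hx
      have hm : e a ∈ A := hA.symm.subset (e_mem_Rc a)
      have h : x * ⟨e a, hm⟩ = x := Subtype.ext (mul_e_eq_self hle)
      rw [← h]
      exact Ideal.mul_mem_left _ x (Ideal.subset_span ⟨a, ha, rfl⟩)
  · intro α hα
    obtain ⟨hc, a, ha, hle⟩ := mem_Oc_iff.1 hα
    exact ⟨a, ha, α, hc, (mul_e_eq_self hle).symm⟩
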